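/- Fix $\gamma>0$. There are constants $K_1,K_2,K_3>0$ depending only on $\gamma$ such that the following holds. Let $\mathcal X\subseteq\mathbb R^d$ be measurable, and let $dx$ denote a reference measure on $\mathcal X$ (for instance Lebesgue measure). A *model* is a measurable function $F$ with $\gamma\le F(x)\le 1$ for all $x\in\mathcal X$ and $\int_{\mathcal X}F(x)\,dx=1$. For models $F,G$ and sample points $x_1,\dots,x_n\in\mathcal X$ put $$d_{\mathcal P}(F,G)=\int_{\mathcal X}F(x)\log\frac{F(x)}{G(x)}\,dx,\qquad \hat d_{\mathcal P}(F,G)=\sum_{i=1}^n F(x_i)\log\frac{F(x_i)}{G(x_i)}.$$ Let $\mathcal P$ be the probability measure on $\mathcal X$ obtained by normalizing $dx$ (the uniform distribution, if $dx$ is Lebesgue measure). Let $F^\star=f^\star\circ h^\star$ (ground truth) and $F_w=f_w\circ h_w$ (weak model) be models, let $h_s:\mathbb R^d\to\mathbb R^{d_s}$ be the strong representation, and let $\mathcal F_s$ be a convex set of functions on $\mathbb R^{d_s}$ such that $f\circ h_s$ is a model for every $f\in\mathcal F_s$. Assume that the class $V_s=\{f\circ h_s: f\in\mathcal F_s\}$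 is pointwise measurable (each member is on $\mathcal X$ the pointwise limit of a sequence from a fixed countable subclass). Let $$\mathcal R_n(V_s)=\mathbb E_{x_1,\dots,x_n\sim\mathcal P}\,\mathbb E_{\sigma\in\{-1,1\}^n}\,\sup_{v\in V_s}\frac1n\sum_{i=1}^n\sigma_i v(x_i)$$ be its Rademacher complexity, and suppose that $\mathcal C_{\mathcal F_s}=\sup_{n\ge1} n\,\mathcal R_n(V_s)^2$, the least constant with $\mathcal R_n(V_s)\le\sqrt{\mathcal C_{\mathcal F_s}/n}$ for all $n\ge 1$, is finite. Let $f_s\in\mathcal F_s$ minimize $f\mapsto d_{\mathcal P}(F^\star,f\circ h_s)$ over $\mathcal F_s$, put $F_s=f_s\circ h_s$ and $\varepsilon=d_{\mathcal P}(F^\star,F_s)$ (realizability, that is $F_s=F^\star$, is not assumed). Then for every $n\ge1$ and $\delta\in(0,1)$, with probability at least $1-\delta$ over $n$ i.i.d. samples $x_1,\dots,x_n\sim\mathcal P$, every empirical reverse-KL minimizer $\hat f_{sw}\in\operatorname{argmin}_{f\in\mathcal F_s}\hat d_{\mathcal P}(f\circ h_s,F_w)$, with $\hat F_{sw}=\hat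 f_{sw}\circ h_s$, satisfies $$d_{\mathcal P}(F^\star,\hat F_{sw})\le d_{\mathcal P}(F^\star,F_w)-d_{\mathcal P}(\hat F_{sw},F_w)+K_1\sqrt{\varepsilon}+K_2\sqrt{\frac{\mathcal C_{\mathcal F_s}}{n}}+K_3\sqrt{\frac{\log(1/\delta)}{n}}.$$ -/

import Mathlib

open MeasureTheory Filter Topology

namespace WeakToStrong

/-- `ℝ^d` with its Euclidean structure. -/
abbrev Vec (d : ℕ) : Type := EuclideanSpace ℝ (Fin d)

/-- A (regression) model on the data domain `X`: a measurable function with outputs in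
`{y : γ ≤ y ≤ 1}`, normalized to be a probability density on `X` with respect to the
reference measure `μ` (the `dx` of the integrals over `X`). -/
structure IsModel {d : ℕ} (μ : Measure (Vec d)) (X : Set (Vec d)) (γ : ℝ)
    (F : Vec d → ℝ) : Prop where
  measurable : Measurable F
  lower : ∀ x ∈ X, γ ≤ F x
  upper : ∀ x ∈ X, F x ≤ 1
  normalized : ∫ x in X, F x ∂μ = 1

/-- Output distribution divergence `∫_X f(x) log (f(x) / g(x)) dx`. -/
noncomputable def outputDiv {d : ℕ} (μ : Measure (Vec d)) (X : Set (Vec d))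
    (f g : Vec d → ℝ) : ℝ :=
  ∫ x in X, f x * Real.log (f x / g x) ∂μ

/-- Empirical output distribution divergence `∑ i, f(x_i) log (f(x_i) / g(x_i))` on the sample
`x_1, …, x_n`. -/
noncomputable def empOutputDiv {d n : ℕ} (x : Fin n → Vec d) (f g : Vec d → ℝ) : ℝ :=
  ∑ i, f (x i) * Real.log (f (x i) / g (x i))

/-- The data distribution `𝒫`: the reference measure on `X`, normalized to be a probability
measure (the uniform distribution on `X` if `μ` is Lebesgue measure). -/
noncomputable def dataDist {d : ℕ} (μ : Measure (Vec d)) (X : Set (Vec d)) : Measure (Vec d) :=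
  ProbabilityTheory.cond μ X

/-- The law of `n` i.i.d. samples from the data distribution. -/
noncomputable def sampleLaw {d : ℕ} (μ : Measure (Vec d)) (X : Set (Vec d)) (n : ℕ) :
    Measure (Fin n → Vec d) :=
  Measure.pi fun _ => dataDist μ X

/-- The class `{f ∘ h : f ∈ 𝓕}` of all tasks of `𝓕` composed with the representation `h`. -/
def composedClass {d k : ℕ} (𝓕 : Set (Vec k → ℝ)) (h : Vec d → Vec k) : Set (Vec d → ℝ) :=
  (fun f => f ∘ h) '' 𝓕

/-- The sign `±1` encoded by a Boolean. -/
def sign (b : Bool) : ℝ := if b then 1 else -1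

/-- Rademacher complexity
`E_{x_1, …, x_n} E_{σ uniform in {-1, 1}^n} sup_{v ∈ V} (1 / n) ∑ i, σ_i v(x_i)`. -/
noncomputable def rademacher {d : ℕ} (μ : Measure (Vec d)) (X : Set (Vec d))
    (V : Set (Vec d → ℝ)) (n : ℕ) : ℝ :=
  ∫ x : Fin n → Vec d,
    ((2 : ℝ) ^ n)⁻¹ * ∑ σ : Fin n → Bool, ⨆ v : V, (n : ℝ)⁻¹ * ∑ i, sign (σ i) * v.1 (x i)
    ∂(sampleLaw μ X n)

/-- The complexity constant of a class: the least `C` such that the Rademacher complexity of the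
class is at most `√(C / n)` for every sample size `n ≥ 1` (`∞` if there is none). -/
noncomputable def complexityConst {d : ℕ} (μ : Measure (Vec d)) (X : Set (Vec d))
    (V : Set (Vec d → ℝ)) : ENNReal :=
  ⨆ n : ℕ, ENNReal.ofReal ((n : ℝ) * rademacher μ X V n ^ 2)

/-- The usual measurability condition on a class of functions ("pointwise measurable class"):
every member is on `X` the pointwise limit of a sequence from a fixed countable subclass. It makes
suprema of empirical processes over the class measurable. -/
def PointwiseMeasurableOn {d : ℕ} (X : Set (Vec d)) (V : Set (Vec d → ℝ)) : Prop :=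
  ∃ D ⊆ V, D.Countable ∧ ∀ v ∈ V, ∃ u : ℕ → Vec d → ℝ,
    (∀ j, u j ∈ D) ∧ ∀ x ∈ X, Tendsto (fun j => u j x) atTop (𝓝 (v x))

end WeakToStrong

/-! ### Suprema of signed sums and the contraction principle. -/

namespace WeakToStrong

/-! Write `G`, `H`, `S`, `F` for the ground truth, the weak model, the strong ceiling and the
empirical minimizer. The defect `d(G,F) + d(F,H) - d(G,H)` in the desired inequality equals `∫ (F -
G) log (F/H)` (`outputDiv_add_sub`). Split `F - G` as `(F - S) + (S - G)`. The second piece is at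
most `(1/γ) ‖S - G‖₁`, which a Pinsker-type bound (`integral_abs_sub_le`) turns into the `√ε` term.

The first piece is `∫ lossGrad S H F`, the directional derivative at `F`, along `F - S`, of the
reverse-KL loss. Its empirical counterpart is nonpositive, because the segment from the minimizer
`F` to `S` stays in the convex class (`sum_lossGrad_nonpos`). What remains is a one-sided deviation
bound for `lossGrad`, uniform over the class since `F` depends on the sample: McDiarmid's inequality
for the concentration, symmetrization for the mean, and contraction, since `lossGrad` is Lipschitz
in the model value, to reach the Rademacher complexity of the class itself. Pointwise measurability
reduces all suprema to a countable subclass (`exists_event_setIntegral_lossGrad_le`). -/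

theorem bddAbove_range_of_abs_le {ι : Sort*} {f : ι → ℝ} {M : ℝ} (h : ∀ i, |f i| ≤ M) :
    BddAbove (Set.range f) :=
  ⟨M, by rintro _ ⟨i, rfl⟩; exact (abs_le.1 (h i)).2⟩

theorem abs_iSup_le {ι : Sort*} [Nonempty ι] {f : ι → ℝ} {M : ℝ} (h : ∀ i, |f i| ≤ M) :
    |⨆ i, f i| ≤ M := by
  obtain ⟨i⟩ := ‹Nonempty ι›
  exact abs_le.2 ⟨(abs_le.1 (h i)).1.trans (le_ciSup (bddAbove_range_of_abs_le h) i),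
    haveI : Nonempty ι := ⟨i⟩; ciSup_le fun j => (abs_le.1 (h j)).2⟩

theorem iSup_le_iSup_add {ι : Sort*} [Nonempty ι] {f g : ι → ℝ} {c : ℝ}
    (hg : BddAbove (Set.range g)) (h : ∀ i, f i ≤ g i + c) : ⨆ i, f i ≤ (⨆ i, g i) + c :=
  ciSup_le fun i => (h i).trans (by gcongr; exact le_ciSup hg i)

theorem abs_sign (b : Bool) : |sign b| = 1 := by cases b <;> simp [sign]

theorem sign_not (b : Bool) : sign (!b) = -sign b := by cases b <;> simp [sign]

theorem abs_sum_mul_le {n : ℕ} {s b : Fin n → ℝ} {M : ℝ} (hs : ∀ k, |s k| = 1)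
    (hb : ∀ k, |b k| ≤ M) : |∑ k, s k * b k| ≤ n * M := by
  calc |∑ k, s k * b k| ≤ ∑ k, |s k * b k| := Finset.abs_sum_le_sum_abs _ _
    _ ≤ ∑ _k : Fin n, M := Finset.sum_le_sum fun k _ => by rw [abs_mul, hs, one_mul]; exact hb k
    _ = n * M := by simp

theorem abs_avg_le {n : ℕ} (hn : 0 < n) {s b : Fin n → ℝ} {M : ℝ} (hs : ∀ k, |s k| = 1)
    (hb : ∀ k, |b k| ≤ M) : |(n : ℝ)⁻¹ * ∑ k, s k * b k| ≤ M := by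
  have : (0 : ℝ) < n := by exact_mod_cast hn
  rw [abs_mul, abs_of_pos (inv_pos.2 this), inv_mul_le_iff₀ this]
  exact abs_sum_mul_le hs hb

theorem sum_fin_succ_bool {n : ℕ} (F : (Fin (n + 1) → Bool) → ℝ) :
    ∑ σ, F σ = ∑ σ : Fin n → Bool, (F (Fin.cons true σ) + F (Fin.cons false σ)) := by
  rw [← (Fin.consEquiv fun _ => Bool).sum_comp, Fintype.sum_prod_type]
  simp [Fin.consEquiv, Finset.sum_add_distrib]

/-- One coordinate of the contraction, averaged over its sign. For near-maximizers `i`, `j` on the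
left, `b i - b j` is at most `c i - c j` or `c j - c i`; in the second case `i` and `j` exchange
roles on the right, so no absolute value is needed. -/
theorem iSup_add_iSup_le {ι : Type*} [Nonempty ι] {a b c : ι → ℝ}
    (hp : BddAbove (Set.range fun i => a i + c i)) (hm : BddAbove (Set.range fun i => a i - c i))
    (h : ∀ i j, |b i - b j| ≤ |c i - c j|) :
    (⨆ i, (a i + b i)) + (⨆ i, (a i - b i)) ≤ (⨆ i, (a i + c i)) + ⨆ i, (a i - c i) := by
  have key : ∀ i j, (a i + b i) + (a j - b j) ≤ (⨆ i, (a i + c i)) + ⨆ i, (a i - c i) := by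
    intro i j
    have h1 := le_ciSup hp i
    have h2 := le_ciSup hm j
    have h3 := le_ciSup hp j
    have h4 := le_ciSup hm i
    have h5 := (le_abs_self _).trans (h i j)
    rcases abs_cases (c i - c j) with ⟨h6, _⟩ | ⟨h6, _⟩ <;> linarith
  have : ∀ i, a i + b i ≤ (⨆ i, (a i + c i)) + (⨆ i, (a i - c i)) - ⨆ i, (a i - b i) := by
    intro i
    have : (⨆ j, (a j - b j)) ≤ (⨆ i, (a i + c i)) + (⨆ i, (a i - c i)) - (a i + b i) :=
      ciSup_le fun j => by linarith [key i j]
    linarith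
  linarith [ciSup_le this]

/-- The **contraction principle** for Rademacher averages, without absolute values. -/
theorem sum_iSup_sign_mul_le {ι : Type*} [Nonempty ι] {M : ℝ} :
    ∀ (n : ℕ) (A : ℝ) (a : ι → ℝ) (b c : ι → Fin n → ℝ), (∀ i, |a i| ≤ A) →
      (∀ i k, |b i k| ≤ M) → (∀ i k, |c i k| ≤ M) →
      (∀ i j k, |b i k - b j k| ≤ |c i k - c j k|) →
      ∑ σ : Fin n → Bool, ⨆ i, (a i + ∑ k, sign (σ k) * b i k) ≤
        ∑ σ : Fin n → Bool, ⨆ i, (a i + ∑ k, sign (σ k) * c i k) := by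
  intro n
  induction n with
  | zero => intro A a b c _ _ _ _; simp
  | succ n ih =>
    intro A a b c ha hb hc h
    rw [sum_fin_succ_bool, sum_fin_succ_bool]
    simp only [Fin.sum_univ_succ, Fin.cons_zero, Fin.cons_succ]
    have step1 : ∀ s : Bool,
        ∑ σ : Fin n → Bool, ⨆ i, (a i + (sign s * b i 0 + ∑ k, sign (σ k) * b i k.succ)) ≤
        ∑ σ : Fin n → Bool, ⨆ i, (a i + (sign s * b i 0 + ∑ k, sign (σ k) * c i k.succ)) := by
      intro s
      simp only [← add_assoc]
      -- The offset `a` exists for this: the first signed term is absorbed into it while the other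
      -- coordinates are contracted.
      refine ih (A + M) (fun i => a i + sign s * b i 0) (fun i k => b i k.succ)
        (fun i k => c i k.succ) (fun i => ?_) (fun i k => hb _ _) (fun i k => hc _ _)
        (fun i j k => h _ _ _)
      refine (abs_add_le _ _).trans (add_le_add (ha i) ?_)
      rw [abs_mul, abs_sign, one_mul]; exact hb _ _
    rw [Finset.sum_add_distrib]
    refine (add_le_add (step1 true) (step1 false)).trans ?_
    rw [← Finset.sum_add_distrib]
    refine Finset.sum_le_sum fun σ _ => ?_
    have hbd : ∀ s : ℝ, |s| = 1 → ∀ i,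
        |a i + (∑ k, sign (σ k) * c i k.succ) + s * c i 0| ≤ A + n * M + M := by
      intro s hs i
      refine (abs_add_le _ _).trans (add_le_add ((abs_add_le _ _).trans
        (add_le_add (ha i) ?_)) ?_)
      · exact abs_sum_mul_le (fun k => abs_sign _) fun k => hc _ _
      · rw [abs_mul, hs, one_mul]; exact hc _ _
    have := iSup_add_iSup_le (a := fun i => a i + ∑ k, sign (σ k) * c i k.succ)
      (b := fun i => b i 0) (c := fun i => c i 0)
      (bddAbove_range_of_abs_le fun i => by simpa using hbd 1 (by simp) i)
      (bddAbove_range_of_abs_le fun i => by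
        simpa [sub_eq_add_neg] using hbd (-1) (by simp) i) (fun i j => h i j 0)
    simp only [sign, if_true, Bool.false_eq_true, if_false, one_mul, neg_one_mul] at this ⊢
    simp only [sub_eq_add_neg, add_comm, add_left_comm] at this ⊢
    exact this

end WeakToStrong

/-! ### McDiarmid's inequality. -/

namespace WeakToStrong

variable {Ω : Type*} [MeasurableSpace Ω]

theorem integrable_of_abs_le {μ : Measure Ω} [IsFiniteMeasure μ] {f : Ω → ℝ} (hf : Measurable f)
    {B : ℝ} (hB : ∀ x, |f x| ≤ B) : Integrable f μ :=
  Integrable.of_bound hf.aestronglyMeasurable B (ae_of_all _ hB)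

theorem abs_integral_le {μ : Measure Ω} [IsProbabilityMeasure μ] {f : Ω → ℝ} {B : ℝ}
    (hB : ∀ x, |f x| ≤ B) : |∫ x, f x ∂μ| ≤ B := by
  simpa using norm_integral_le_of_norm_le_const (μ := μ) (f := f) (ae_of_all _ hB)

/-- **Hoeffding's lemma** for a function whose oscillation is at most `c`. -/
theorem integral_exp_mul_le_of_osc_le {P : Measure Ω} [IsProbabilityMeasure P] {f : Ω → ℝ}
    (hf : Measurable f) {B c : ℝ} (hB : ∀ x, |f x| ≤ B) (hc : ∀ x y, |f x - f y| ≤ c) (t : ℝ) :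
    ∫ x, Real.exp (t * f x) ∂P ≤ Real.exp (t * ∫ x, f x ∂P + c ^ 2 * t ^ 2 / 8) := by
  have hne : Nonempty Ω := nonempty_of_isProbabilityMeasure P
  have hbd : BddBelow (Set.range f) :=
    ⟨-B, by rintro _ ⟨x, rfl⟩; exact (abs_le.1 (hB x)).1⟩
  -- An interval of length `c` gives variance proxy `(c/2)²`, whence the factor `1/8`.
  have hmem : ∀ x, f x ∈ Set.Icc (⨅ y, f y) ((⨅ y, f y) + c) := fun x =>
    ⟨ciInf_le hbd x, by
      have : f x - c ≤ ⨅ y, f y := le_ciInf fun y => by linarith [(abs_le.1 (hc x y)).2]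
      linarith⟩
  have h := (ProbabilityTheory.hasSubgaussianMGF_of_mem_Icc (μ := P) hf.aemeasurable
    (ae_of_all _ hmem)).mgf_le t
  simp only [ProbabilityTheory.mgf, mul_sub, Real.exp_sub] at h
  rw [integral_div, div_le_iff₀ (Real.exp_pos _), ← Real.exp_add] at h
  refine h.trans (le_of_eq ?_)
  congr 1
  simp only [add_sub_cancel_left, NNReal.coe_pow, NNReal.coe_div, coe_nnnorm, Real.norm_eq_abs,
    NNReal.coe_ofNat, div_pow, sq_abs]
  ring

theorem integral_pi_succ {n : ℕ} (P : Measure Ω) [IsProbabilityMeasure P]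
    {g : (Fin (n + 1) → Ω) → ℝ} (hg : Measurable g) {B : ℝ} (hB : ∀ x, |g x| ≤ B) :
    ∫ x, g x ∂(Measure.pi fun _ => P) =
      ∫ y, ∫ a, g (Fin.cons a y) ∂P ∂(Measure.pi fun _ : Fin n => P) := by
  have hmp := (measurePreserving_piFinSuccAbove (fun _ : Fin (n + 1) => P) 0).symm
  rw [← hmp.integral_comp', integral_prod_symm]
  · simp [MeasurableEquiv.piFinSuccAbove, Fin.insertNthEquiv]
  · exact integrable_of_abs_le (hg.comp (MeasurableEquiv.measurable _)) fun x => hB _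

theorem measurable_finCons {n : ℕ} :
    Measurable fun p : Ω × (Fin n → Ω) => (Fin.cons p.1 p.2 : Fin (n + 1) → Ω) := by
  refine measurable_pi_iff.2 fun k => ?_
  refine Fin.cases ?_ (fun k => ?_) k
  · simpa using measurable_fst
  · simpa [Function.comp_def] using (measurable_pi_apply k).comp measurable_snd

/-- The exponential moment bound behind **McDiarmid's inequality**. -/
theorem integral_exp_mul_le_of_boundedDifferences (P : Measure Ω) [IsProbabilityMeasure P]
    {B c : ℝ} (t : ℝ) : ∀ (n : ℕ) (g : (Fin n → Ω) → ℝ), Measurable g → (∀ x, |g x| ≤ B) →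
      (∀ x k y, |g (Function.update x k y) - g x| ≤ c) →
      ∫ x, Real.exp (t * g x) ∂(Measure.pi fun _ => P) ≤
        Real.exp (t * ∫ x, g x ∂(Measure.pi fun _ => P) + n * (c ^ 2 * t ^ 2 / 8)) := by
  intro n
  induction n with
  | zero =>
    intro g hg hB hc
    obtain ⟨r, rfl⟩ : ∃ r, g = fun _ => r :=
      ⟨g isEmptyElim, funext fun x => congrArg g (Subsingleton.elim _ _)⟩
    simp
  | succ n ih =>
    intro g hg hB hc
    have hgc : Measurable fun p : Ω × (Fin n → Ω) => g (Fin.cons p.1 p.2) :=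
      hg.comp measurable_finCons
    have hgc' : ∀ y : Fin n → Ω, Measurable fun a => g (Fin.cons a y) := fun y =>
      hgc.comp (measurable_id.prodMk measurable_const)
    -- Averaging out the first coordinate preserves the bound and the bounded differences, so
    -- induction applies to `h`; Hoeffding's lemma handles the first coordinate with the others
    -- frozen.
    set h : (Fin n → Ω) → ℝ := fun y => ∫ a, g (Fin.cons a y) ∂P with h_def
    have hh : Measurable h :=
      (StronglyMeasurable.integral_prod_right (f := fun (y : Fin n → Ω) a => g (Fin.cons a y))
        (hgc.comp measurable_swap).stronglyMeasurable).measurable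
    have hhB : ∀ y, |h y| ≤ B := fun y => abs_integral_le fun a => hB _
    have hhc : ∀ x k y, |h (Function.update x k y) - h x| ≤ c := by
      intro x k y
      rw [h_def, ← integral_sub (integrable_of_abs_le (hgc' _) fun a => hB _)
        (integrable_of_abs_le (hgc' _) fun a => hB _)]
      refine abs_integral_le fun a => ?_
      have := hc (Fin.cons a x) k.succ y
      rwa [← Fin.cons_update] at this
    have hexpB : ∀ s : ℝ, |s| ≤ B → |Real.exp (t * s)| ≤ Real.exp (|t| * B) := fun s hs => by
      rw [abs_of_pos (Real.exp_pos _)]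
      refine Real.exp_le_exp.2 ((le_abs_self _).trans ?_)
      rw [abs_mul]; gcongr
    rw [integral_pi_succ P (by fun_prop) fun x => hexpB _ (hB x), integral_pi_succ P hg hB]
    have step : ∀ y : Fin n → Ω, ∫ a, Real.exp (t * g (Fin.cons a y)) ∂P ≤
        Real.exp (t * h y) * Real.exp (c ^ 2 * t ^ 2 / 8) := by
      intro y
      rw [← Real.exp_add]
      refine integral_exp_mul_le_of_osc_le (hgc' y) (fun a => hB _) (fun a b => ?_) t
      have := hc (Fin.cons b y) 0 a
      rwa [Fin.update_cons_zero] at this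
    have hm : Measurable fun y : Fin n → Ω => ∫ a, Real.exp (t * g (Fin.cons a y)) ∂P :=
      (StronglyMeasurable.integral_prod_right (f := fun (y : Fin n → Ω) a =>
        Real.exp (t * g (Fin.cons a y))) (by
          have := hgc.comp measurable_swap
          exact (Real.measurable_exp.comp (this.const_mul t)).stronglyMeasurable)).measurable
    calc _ ≤ ∫ y, Real.exp (t * h y) * Real.exp (c ^ 2 * t ^ 2 / 8)
          ∂(Measure.pi fun _ : Fin n => P) := by
          refine integral_mono (integrable_of_abs_le hm fun y => abs_integral_le fun a =>
            hexpB _ (hB _)) (Integrable.mul_const ?_ _) step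
          exact integrable_of_abs_le (by fun_prop) fun y => hexpB _ (hhB y)
      _ ≤ Real.exp (t * ∫ y, h y ∂(Measure.pi fun _ : Fin n => P) + n * (c ^ 2 * t ^ 2 / 8))
          * Real.exp (c ^ 2 * t ^ 2 / 8) := by
          rw [integral_mul_const]
          gcongr
          exact ih h hh hhB hhc
      _ = _ := by
          rw [← Real.exp_add]; congr 1; push_cast; ring

/-- **McDiarmid's inequality** for functions of i.i.d. variables. -/
theorem measureReal_ge_le_of_boundedDifferences (P : Measure Ω) [IsProbabilityMeasure P]
    {B c s : ℝ} {n : ℕ} {g : (Fin n → Ω) → ℝ} (hg : Measurable g) (hB : ∀ x, |g x| ≤ B)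
    (hc : ∀ x k y, |g (Function.update x k y) - g x| ≤ c) (hs : 0 ≤ s) :
    (Measure.pi fun _ => P).real
        {x | (∫ y, g y ∂(Measure.pi fun _ => P)) + s ≤ g x} ≤
      Real.exp (-2 * s ^ 2 / (n * c ^ 2)) := by
  -- The moment bound says that the centred `g` is sub-Gaussian with parameter `n (c/2)²`; the tail
  -- is then Chernoff's bound.
  have key : ProbabilityTheory.HasSubgaussianMGF
      (fun x => g x - ∫ y, g y ∂(Measure.pi fun _ => P)) (n * (‖c‖₊ / 2) ^ 2)
      (Measure.pi fun _ => P) := by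
    constructor
    · intro t
      refine integrable_of_abs_le (B := Real.exp (|t| * (B + B))) (by fun_prop) fun x => ?_
      rw [abs_of_pos (Real.exp_pos _)]
      refine Real.exp_le_exp.2 ((le_abs_self _).trans ?_)
      rw [abs_mul]; gcongr
      exact (abs_sub _ _).trans (add_le_add (hB x) (abs_integral_le hB))
    · intro t
      have := integral_exp_mul_le_of_boundedDifferences P t n g hg hB hc
      simp only [ProbabilityTheory.mgf, mul_sub, Real.exp_sub]
      rw [integral_div, div_le_iff₀ (Real.exp_pos _), ← Real.exp_add]
      refine this.trans (le_of_eq ?_)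
      congr 1
      simp only [NNReal.coe_mul, NNReal.coe_natCast, NNReal.coe_pow, NNReal.coe_div, coe_nnnorm,
        Real.norm_eq_abs, NNReal.coe_ofNat, div_pow, sq_abs]
      ring
  have h2 := key.measure_ge_le hs
  have e : {x | s ≤ g x - ∫ y, g y ∂(Measure.pi fun _ => P)} =
      {x | (∫ y, g y ∂(Measure.pi fun _ => P)) + s ≤ g x} := by
    ext x; simp only [Set.mem_ofPred_eq]; constructor <;> intro h <;> linarith
  rw [e] at h2
  refine h2.trans (le_of_eq ?_)
  congr 1
  simp only [NNReal.coe_mul, NNReal.coe_natCast, NNReal.coe_pow, NNReal.coe_div, coe_nnnorm,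
        Real.norm_eq_abs, NNReal.coe_ofNat, div_pow, sq_abs]
  rw [show 2 * ((n : ℝ) * (c ^ 2 / 2 ^ 2)) = (n * c ^ 2) / 2 by ring, div_div_eq_mul_div]
  ring

end WeakToStrong

/-! ### Symmetrization and uniform deviations. -/

namespace WeakToStrong

variable {Ω ι : Type*} [MeasurableSpace Ω]

/-- The signed average over a sample, maximized over a family of functions. -/
noncomputable def signedSup {n : ℕ} (u : ι → Ω → ℝ) (σ : Fin n → Bool) (x : Fin n → Ω) : ℝ :=
  ⨆ i, (n : ℝ)⁻¹ * ∑ k, sign (σ k) * u i (x k)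

theorem integral_comp_of_measurePreserving {Ω' : Type*} [MeasurableSpace Ω'] {μ : Measure Ω}
    {ν : Measure Ω'} {f : Ω → Ω'} (h : MeasurePreserving f μ ν) {g : Ω' → ℝ} (hg : Measurable g) :
    ∫ x, g (f x) ∂μ = ∫ y, g y ∂ν := by
  rw [← h.map_eq, integral_map h.measurable.aemeasurable hg.aestronglyMeasurable]

omit [MeasurableSpace Ω] in
theorem abs_signedSup_le [Nonempty ι] {n : ℕ} (hn : 0 < n) {u : ι → Ω → ℝ} {B : ℝ}
    (hB : ∀ i x, |u i x| ≤ B) (σ : Fin n → Bool) (x : Fin n → Ω) : |signedSup u σ x| ≤ B :=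
  abs_iSup_le fun _ => abs_avg_le hn (fun _ => abs_sign _) fun _ => hB _ _

theorem measurable_signedSup [Countable ι] {n : ℕ} {u : ι → Ω → ℝ} (hu : ∀ i, Measurable (u i))
    (σ : Fin n → Bool) : Measurable (signedSup u σ) := by
  unfold signedSup
  refine Measurable.iSup fun i => ?_
  have := hu i
  fun_prop

/-- The empirical Rademacher complexity of a family of functions. -/
noncomputable def empRademacher {n : ℕ} (u : ι → Ω → ℝ) (x : Fin n → Ω) : ℝ :=
  ((2 : ℝ) ^ n)⁻¹ * ∑ σ : Fin n → Bool, signedSup u σ x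

/-- The largest deviation of the mean from the empirical mean over a family of functions. -/
noncomputable def supDeviation {n : ℕ} (P : Measure Ω) (u : ι → Ω → ℝ) (x : Fin n → Ω) : ℝ :=
  ⨆ i, (∫ ω, u i ω ∂P - (n : ℝ)⁻¹ * ∑ k, u i (x k))

section

variable {P : Measure Ω} [IsProbabilityMeasure P] {n : ℕ} {u : ι → Ω → ℝ} {B : ℝ}

theorem abs_integral_sub_avg_le (hn : 0 < n) (hB : ∀ i x, |u i x| ≤ B) (x : Fin n → Ω) (i : ι) :
    |∫ ω, u i ω ∂P - (n : ℝ)⁻¹ * ∑ k, u i (x k)| ≤ B + B := by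
  refine (abs_sub _ _).trans (add_le_add (abs_integral_le (hB i)) ?_)
  simpa using abs_avg_le hn (s := fun _ => 1) (by simp) fun k => hB i (x k)

theorem abs_supDeviation_le [Nonempty ι] (hn : 0 < n) (hB : ∀ i x, |u i x| ≤ B)
    (x : Fin n → Ω) : |supDeviation P u x| ≤ B + B :=
  abs_iSup_le fun i => abs_integral_sub_avg_le hn hB x i

omit [IsProbabilityMeasure P] in
theorem measurable_supDeviation [Countable ι] (hu : ∀ i, Measurable (u i)) :
    Measurable (supDeviation P u : (Fin n → Ω) → ℝ) := by
  unfold supDeviation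
  refine Measurable.iSup fun i => ?_
  have := hu i
  fun_prop

theorem supDeviation_update_le [Nonempty ι] (hn : 0 < n) (hB : ∀ i x, |u i x| ≤ B)
    (x x' : Fin n → Ω) (k : Fin n) (h : ∀ j ≠ k, x' j = x j) :
    supDeviation P u x' ≤ supDeviation P u x + 2 * B / n := by
  have hn' : (0 : ℝ) < n := by exact_mod_cast hn
  refine iSup_le_iSup_add (bddAbove_range_of_abs_le fun i => abs_integral_sub_avg_le hn hB x i)
    fun i => ?_
  have : ∑ j, u i (x j) - ∑ j, u i (x' j) ≤ 2 * B := by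
    rw [← Finset.sum_sub_distrib, Finset.sum_eq_single k]
    · linarith [(abs_le.1 (hB i (x k))).2, (abs_le.1 (hB i (x' k))).1]
    · intro j _ hj; rw [h j hj, sub_self]
    · simp
  have h2 : (n : ℝ)⁻¹ * (∑ j, u i (x j) - ∑ j, u i (x' j)) ≤ (n : ℝ)⁻¹ * (2 * B) := by gcongr
  rw [mul_sub] at h2
  rw [div_eq_inv_mul]
  linarith

/-- Ghost sample: the mean is the expected average over an independent second sample, and a supremum
of expectations is at most the expectation of the supremum. -/
theorem integral_supDeviation_le_pairs [Countable ι] [Nonempty ι] (hn : 0 < n)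
    (hu : ∀ i, Measurable (u i)) (hB : ∀ i x, |u i x| ≤ B) :
    ∫ x : Fin n → Ω, supDeviation P u x ∂(Measure.pi fun _ => P) ≤
      ∫ z : Fin n → Ω × Ω, (⨆ i, (n : ℝ)⁻¹ * ∑ k, (u i (z k).2 - u i (z k).1))
        ∂(Measure.pi fun _ => P.prod P) := by
  have hmp := (measurePreserving_arrowProdEquivProdArrow Ω Ω (Fin n) (fun _ => P)
    (fun _ => P)).symm
  rw [← hmp.integral_comp']
  set H : (Fin n → Ω) × (Fin n → Ω) → ℝ :=
    fun p => ⨆ i, (n : ℝ)⁻¹ * ∑ k, (u i (p.2 k) - u i (p.1 k)) with H_def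
  have hbd : ∀ p : (Fin n → Ω) × (Fin n → Ω), ∀ i,
      |(n : ℝ)⁻¹ * ∑ k, (u i (p.2 k) - u i (p.1 k))| ≤ B + B := fun p i => by
    simpa using abs_avg_le hn (s := fun _ => 1) (by simp) fun k =>
      (abs_sub (u i (p.2 k)) (u i (p.1 k))).trans (add_le_add (hB _ _) (hB _ _))
  have hHB : ∀ p, |H p| ≤ B + B := fun p => abs_iSup_le (hbd p)
  have hHm : Measurable H := by
    refine Measurable.iSup fun i => ?_
    have := hu i
    fun_prop
  change _ ≤ ∫ p, H p ∂_
  rw [integral_prod _ (integrable_of_abs_le hHm hHB)]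
  refine integral_mono (integrable_of_abs_le (measurable_supDeviation hu)
    (abs_supDeviation_le hn hB)) (integrable_of_abs_le
      hHm.stronglyMeasurable.integral_prod_right'.measurable
      fun x => abs_integral_le fun y => hHB _) fun x => ?_
  refine ciSup_le fun i => ?_
  have hint : ∀ k : Fin n, Integrable (fun y : Fin n → Ω => u i (y k))
      (Measure.pi fun _ => P) := fun k =>
    integrable_of_abs_le ((hu i).comp (measurable_pi_apply k)) fun y => hB i _
  have heval : ∀ k : Fin n, ∫ y : Fin n → Ω, u i (y k) ∂(Measure.pi fun _ => P) =
      ∫ ω, u i ω ∂P := fun k =>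
    integral_comp_of_measurePreserving (measurePreserving_eval (fun _ : Fin n => P) k) (hu i)
  have hn' : (n : ℝ) ≠ 0 := by exact_mod_cast hn.ne'
  have : ∫ ω, u i ω ∂P - (n : ℝ)⁻¹ * ∑ k, u i (x k) =
      ∫ y : Fin n → Ω, (n : ℝ)⁻¹ * ∑ k, (u i (y k) - u i (x k)) ∂(Measure.pi fun _ => P) := by
    rw [integral_const_mul, integral_finsetSum (f := fun k (y : Fin n → Ω) =>
      u i (y k) - u i (x k)) _ fun k _ => (hint k).sub (integrable_const _)]
    simp_rw [integral_sub (hint _) (integrable_const _), heval]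
    simp only [integral_const, probReal_univ, smul_eq_mul, one_mul, Finset.sum_sub_distrib,
      Finset.sum_const, Finset.card_univ, Fintype.card_fin, nsmul_eq_mul]
    field_simp
  rw [this]
  refine integral_mono (integrable_of_abs_le ?_ fun y => hbd (x, y) i)
    (integrable_of_abs_le (hHm.comp measurable_prodMk_left) fun y => hHB _) fun y => ?_
  · have := hu i
    fun_prop
  · exact le_ciSup (bddAbove_range_of_abs_le (hbd (x, y))) i

/-- The **symmetrization inequality**. -/
theorem integral_supDeviation_le [Countable ι] [Nonempty ι] (hn : 0 < n)
    (hu : ∀ i, Measurable (u i)) (hB : ∀ i x, |u i x| ≤ B) :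
    ∫ x : Fin n → Ω, supDeviation P u x ∂(Measure.pi fun _ => P) ≤
      2 * ∫ x : Fin n → Ω, empRademacher u x ∂(Measure.pi fun _ => P) := by
  refine (integral_supDeviation_le_pairs hn hu hB).trans ?_
  set J := ∫ z : Fin n → Ω × Ω, (⨆ i, (n : ℝ)⁻¹ * ∑ k, (u i (z k).2 - u i (z k).1))
        ∂(Measure.pi fun _ => P.prod P) with J_def
  set S : (Fin n → Bool) → ℝ := fun σ => ∫ x, signedSup u σ x ∂(Measure.pi fun _ => P) with S_def
  have hint : ∀ σ : Fin n → Bool, Integrable (signedSup u σ) (Measure.pi fun _ => P) := fun σ =>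
    integrable_of_abs_le (measurable_signedSup hu σ) (abs_signedSup_le hn hB σ)
  have hfst : MeasurePreserving (fun (z : Fin n → Ω × Ω) k => (z k).1)
      (Measure.pi fun _ => P.prod P) (Measure.pi fun _ => P) :=
    measurePreserving_pi _ _ fun _ => measurePreserving_fst
  have hsnd : MeasurePreserving (fun (z : Fin n → Ω × Ω) k => (z k).2)
      (Measure.pi fun _ => P.prod P) (Measure.pi fun _ => P) :=
    measurePreserving_pi _ _ fun _ => measurePreserving_snd
  -- Exchanging the two members of the pairs with `σ k = false` preserves the law and inserts the
  -- sign `σ k` in each difference. The supremum then splits into one for each sample, with opposite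
  -- signs.
  have key : ∀ σ : Fin n → Bool, J ≤ S σ + S fun k => !σ k := by
    intro σ
    have hswap : MeasurePreserving (fun (z : Fin n → Ω × Ω) k =>
        (if σ k then id else Prod.swap : Ω × Ω → Ω × Ω) (z k))
        (Measure.pi fun _ => P.prod P) (Measure.pi fun _ => P.prod P) :=
      measurePreserving_pi _ _ (f := fun k => if σ k then id else Prod.swap) fun k => by
        split_ifs
        · exact MeasurePreserving.id _
        · exact Measure.measurePreserving_swap
    have hbd : ∀ (z : Fin n → Ω × Ω) i,
        |(n : ℝ)⁻¹ * ∑ k, sign (σ k) * (u i (z k).2 - u i (z k).1)| ≤ B + B := fun z i =>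
      abs_avg_le hn (fun k => abs_sign _) fun k =>
        (abs_sub _ _).trans (add_le_add (hB _ _) (hB _ _))
    have hJ : J = ∫ z : Fin n → Ω × Ω, (⨆ i, (n : ℝ)⁻¹ * ∑ k, sign (σ k) *
        (u i (z k).2 - u i (z k).1)) ∂(Measure.pi fun _ => P.prod P) := by
      rw [J_def, ← integral_comp_of_measurePreserving hswap]
      · congr 1
        ext z
        congr 1
        ext i
        congr 1
        refine Finset.sum_congr rfl fun k _ => ?_
        by_cases hσ : σ k <;> simp [sign, hσ]
      · refine Measurable.iSup fun i => ?_
        have := hu i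
        fun_prop
    have hH : Integrable (fun z : Fin n → Ω × Ω => ⨆ i, (n : ℝ)⁻¹ * ∑ k, sign (σ k) *
        (u i (z k).2 - u i (z k).1)) (Measure.pi fun _ => P.prod P) := by
      refine integrable_of_abs_le (Measurable.iSup fun i => ?_) fun z => abs_iSup_le (hbd z)
      have := hu i
      fun_prop
    have e1 : S σ = ∫ z : Fin n → Ω × Ω, signedSup u σ (fun k => (z k).2)
        ∂(Measure.pi fun _ => P.prod P) :=
      (integral_comp_of_measurePreserving hsnd (measurable_signedSup hu _)).symm
    have e2 : S (fun k => !σ k) = ∫ z : Fin n → Ω × Ω, signedSup u (fun k => !σ k)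
        (fun k => (z k).1) ∂(Measure.pi fun _ => P.prod P) :=
      (integral_comp_of_measurePreserving hfst (measurable_signedSup hu _)).symm
    have i1 : Integrable (fun z : Fin n → Ω × Ω => signedSup u σ fun k => (z k).2)
        (Measure.pi fun _ => P.prod P) := hsnd.integrable_comp_of_integrable (hint σ)
    have i2 : Integrable (fun z : Fin n → Ω × Ω => signedSup u (fun k => !σ k) fun k => (z k).1)
        (Measure.pi fun _ => P.prod P) := hfst.integrable_comp_of_integrable (hint fun k => !σ k)
    rw [hJ, e1, e2, ← integral_add i1 i2]
    refine integral_mono hH (i1.add i2) fun z => ciSup_le fun i => ?_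
    have b1 := le_ciSup (bddAbove_range_of_abs_le fun i => abs_avg_le hn
      (fun k => abs_sign (σ k)) fun k => hB i (z k).2) i
    have b2 := le_ciSup (bddAbove_range_of_abs_le fun i => abs_avg_le hn
      (fun k => abs_sign (!σ k)) fun k => hB i (z k).1) i
    refine le_trans (le_of_eq ?_) (add_le_add b1 b2)
    rw [← mul_add, ← Finset.sum_add_distrib]
    congr 1
    refine Finset.sum_congr rfl fun k _ => ?_
    rw [sign_not]; ring
  have hsum := Finset.sum_le_sum fun σ (_ : σ ∈ (Finset.univ : Finset (Fin n → Bool))) => key σ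
  -- Flipping all signs permutes the sign vectors, so both halves have the same average; this is the
  -- factor `2`.
  have hinv : ∑ σ : Fin n → Bool, S (fun k => !σ k) = ∑ σ, S σ :=
    (Equiv.arrowCongr (Equiv.refl (Fin n)) Equiv.boolNot).sum_comp S
  rw [Finset.sum_add_distrib, hinv] at hsum
  simp only [Finset.sum_const, Finset.card_univ, Fintype.card_pi, Fintype.card_bool,
    Finset.prod_const, Fintype.card_fin, nsmul_eq_mul, Nat.cast_pow, Nat.cast_ofNat] at hsum
  have hR : ∫ x : Fin n → Ω, empRademacher u x ∂(Measure.pi fun _ => P) =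
      ((2 : ℝ) ^ n)⁻¹ * ∑ σ, S σ := by
    unfold empRademacher
    rw [integral_const_mul, integral_finsetSum _ fun σ _ => hint σ]
  rw [hR, ← mul_assoc, mul_comm 2, mul_assoc, ← div_eq_inv_mul, le_div_iff₀ (by positivity)]
  linarith

/-- Uniform deviation bound: **McDiarmid's inequality** combined with symmetrization. -/
theorem measureReal_supDeviation_ge_le [Countable ι] [Nonempty ι] (hn : 0 < n)
    (hu : ∀ i, Measurable (u i)) (hB : ∀ i x, |u i x| ≤ B) (hB0 : 0 < B) {s : ℝ} (hs : 0 ≤ s) :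
    (Measure.pi fun _ => P).real {x : Fin n → Ω |
        2 * (∫ y : Fin n → Ω, empRademacher u y ∂(Measure.pi fun _ => P)) + s ≤
          supDeviation P u x} ≤
      Real.exp (-(n * s ^ 2) / (2 * B ^ 2)) := by
  have hn' : (0 : ℝ) < n := by exact_mod_cast hn
  -- Replacing one point changes one summand by at most `2B`, hence the average by at most `2B/n`.
  have hmc := measureReal_ge_le_of_boundedDifferences P (c := 2 * B / n) (s := s)
    (measurable_supDeviation (P := P) (n := n) hu) (abs_supDeviation_le hn hB)
    (fun x k y => by
      rw [abs_le]
      constructor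
      · have := supDeviation_update_le (P := P) hn hB (Function.update x k y) x k
          fun j hj => by rw [Function.update_of_ne hj]
        linarith
      · have := supDeviation_update_le (P := P) hn hB x (Function.update x k y) k
          fun j hj => by rw [Function.update_of_ne hj]
        linarith) hs
  have e : -2 * s ^ 2 / (n * (2 * B / n) ^ 2) = -(n * s ^ 2) / (2 * B ^ 2) := by
    field_simp
  rw [e] at hmc
  refine (measureReal_mono fun x hx => ?_).trans hmc
  have := integral_supDeviation_le (P := P) hn hu hB
  simp only [Set.mem_ofPred_eq] at hx ⊢
  linarith

end

omit [MeasurableSpace Ω] in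
-- The contraction principle with zero offset, comparing `u` with `L * v`, after which `L` leaves
-- the supremum.
theorem empRademacher_contraction [Nonempty ι] {n : ℕ} (hn : 0 < n) {u v : ι → Ω → ℝ} {L B C : ℝ}
    (hL : 0 ≤ L) (hu : ∀ i x, |u i x| ≤ B) (hv : ∀ i x, |v i x| ≤ C)
    (h : ∀ i j x, |u i x - u j x| ≤ L * |v i x - v j x|) (x : Fin n → Ω) :
    empRademacher u x ≤ L * empRademacher v x := by
  have hn' : (0 : ℝ) ≤ (n : ℝ)⁻¹ := by positivity
  have e : ∀ (w : ι → Ω → ℝ) (σ : Fin n → Bool),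
      ⨆ i, ((0 : ℝ) + ∑ k, sign (σ k) * w i (x k)) = n * signedSup w σ x := fun w σ => by
    rw [signedSup, ← Real.mul_iSup_of_nonneg hn', ← mul_assoc,
      mul_inv_cancel₀ (by exact_mod_cast hn.ne'), one_mul]
    simp
  have key := sum_iSup_sign_mul_le (ι := ι) (M := max B (L * C)) n 0 (fun _ => 0)
    (fun i k => u i (x k)) (fun i k => L * v i (x k)) (by simp)
    (fun i k => (hu _ _).trans (le_max_left _ _))
    (fun i k => by
      rw [abs_mul, abs_of_nonneg hL]
      exact (mul_le_mul_of_nonneg_left (hv _ _) hL).trans (le_max_right _ _))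
    (fun i j k => by
      rw [← mul_sub, abs_mul, abs_of_nonneg hL]; exact h _ _ _)
  have e2 : ∀ σ : Fin n → Bool, signedSup (fun i x => L * v i x) σ x = L * signedSup v σ x := by
    intro σ
    rw [signedSup, signedSup, Real.mul_iSup_of_nonneg hL]
    congr 1
    ext i
    rw [mul_left_comm, Finset.mul_sum (a := L)]
    congr 1
    exact Finset.sum_congr rfl fun k _ => by ring
  have h1 := e u
  have h2 := e fun i x => L * v i x
  simp only [h1, h2, e2, ← Finset.mul_sum] at key
  have h3 := le_of_mul_le_mul_left key (by exact_mod_cast hn)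
  rw [empRademacher, empRademacher, mul_left_comm]
  gcongr

end WeakToStrong

/-! ### Scalar inequalities and first-order optimality. -/

namespace WeakToStrong

section RealInequalities

variable {γ a b t t' s w : ℝ}

theorem neg_log_le_inv (hγ : 0 < γ) : -Real.log γ ≤ 1 / γ - 1 := by
  rw [← Real.log_inv, one_div]
  exact Real.log_le_sub_one_of_pos (inv_pos.2 hγ)

theorem abs_log_div_le (hγ : 0 < γ) (ha : a ∈ Set.Icc γ 1) (hb : b ∈ Set.Icc γ 1) :
    |Real.log (a / b)| ≤ 1 / γ := by
  have ha0 := hγ.trans_le ha.1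
  have hb0 := hγ.trans_le hb.1
  rw [Real.log_div ha0.ne' hb0.ne', abs_le]
  have h1 := Real.log_le_log hγ ha.1
  have h2 := Real.log_le_log hγ hb.1
  have h3 := Real.log_nonpos ha0.le ha.2
  have h4 := Real.log_nonpos hb0.le hb.2
  have h5 := neg_log_le_inv hγ
  constructor <;> linarith

theorem log_sub_log_le (hγ : 0 < γ) (ha : γ ≤ a) (hb : γ ≤ b) :
    Real.log a - Real.log b ≤ |a - b| / γ := by
  have ha0 := hγ.trans_le ha
  have hb0 := hγ.trans_le hb
  rw [← Real.log_div ha0.ne' hb0.ne']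
  calc Real.log (a / b) ≤ a / b - 1 := Real.log_le_sub_one_of_pos (by positivity)
    _ = (a - b) / b := by field_simp
    _ ≤ |a - b| / b := by gcongr; exact le_abs_self _
    _ ≤ |a - b| / γ := by gcongr

theorem abs_log_sub_log_le (hγ : 0 < γ) (ha : γ ≤ a) (hb : γ ≤ b) :
    |Real.log a - Real.log b| ≤ |a - b| / γ :=
  abs_le.2 ⟨by have := log_sub_log_le hγ hb ha; rw [abs_sub_comm] at this; linarith,
    log_sub_log_le hγ ha hb⟩

/-- A quadratic lower bound for the Bregman divergence of `t ↦ t log t` on `(0, 1]`. -/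
theorem sq_sub_div_four_le (ha : 0 < a) (hb : 0 < b) (ha1 : a ≤ 1) (hb1 : b ≤ 1) :
    (a - b) ^ 2 / 4 ≤ a * Real.log (a / b) - a + b := by
  -- With `a = p²`, `b = q²`, the bound `log (p/q) ≥ 1 - q/p` makes the right side at least `(p -
  -- q)²`, while `(p² - q²)² = (p - q)² (p + q)² ≤ 4 (p - q)²`.
  obtain ⟨p, hp, rfl⟩ : ∃ p, 0 < p ∧ p ^ 2 = a := ⟨√a, by positivity, Real.sq_sqrt ha.le⟩
  obtain ⟨q, hq, rfl⟩ : ∃ q, 0 < q ∧ q ^ 2 = b := ⟨√b, by positivity, Real.sq_sqrt hb.le⟩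
  have hp1 : p ≤ 1 := by nlinarith
  have hq1 : q ≤ 1 := by nlinarith
  have hlog : 1 - q / p ≤ Real.log (p / q) := by
    have := Real.log_le_sub_one_of_pos (div_pos hq hp)
    rw [← inv_div, Real.log_inv] at this
    rw [← inv_div p q]
    linarith
  have e : p ^ 2 * Real.log (p ^ 2 / q ^ 2) = 2 * p ^ 2 * Real.log (p / q) := by
    rw [← div_pow, Real.log_pow]; push_cast; ring
  have h1 : 2 * p ^ 2 * (1 - q / p) ≤ 2 * p ^ 2 * Real.log (p / q) := by gcongr
  have h2 : 2 * p ^ 2 * (1 - q / p) = 2 * p ^ 2 - 2 * p * q := by field_simp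
  have h3 : (p ^ 2 - q ^ 2) ^ 2 / 4 ≤ (p - q) ^ 2 := by
    have : (p + q) ^ 2 ≤ 4 := by nlinarith
    nlinarith [mul_le_mul_of_nonneg_left this (sq_nonneg (p - q))]
  rw [e]
  linarith [sq_nonneg (p - q)]

/-- The derivative at `t` of the loss `t ↦ t log (t / w)`, in the direction `t - s`. -/
noncomputable def lossGrad (s w t : ℝ) : ℝ := (t - s) * (Real.log (t / w) + 1)

theorem abs_lossGrad_le (hγ : 0 < γ) (hs : s ∈ Set.Icc γ 1) (hw : w ∈ Set.Icc γ 1)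
    (ht : t ∈ Set.Icc γ 1) : |lossGrad s w t| ≤ 1 / γ + 1 := by
  rw [lossGrad, abs_mul]
  have h1 : |t - s| ≤ 1 := abs_le.2 ⟨by linarith [ht.1, hs.2], by linarith [ht.2, hs.1]⟩
  have h2 : |Real.log (t / w) + 1| ≤ 1 / γ + 1 :=
    (abs_add_le _ _).trans (by simpa using abs_log_div_le hγ ht hw)
  calc _ ≤ 1 * (1 / γ + 1) := by gcongr
    _ = _ := one_mul _

/-- The Lipschitz constant for the contraction: `1/γ + 1` comes from varying the factor `t - s`, and
`1/γ` from varying the logarithm. -/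
theorem abs_lossGrad_sub_le (hγ : 0 < γ) (hs : s ∈ Set.Icc γ 1) (hw : w ∈ Set.Icc γ 1)
    (ht : t ∈ Set.Icc γ 1) (ht' : t' ∈ Set.Icc γ 1) :
    |lossGrad s w t - lossGrad s w t'| ≤ (2 / γ + 1) * |t - t'| := by
  have e : lossGrad s w t - lossGrad s w t' =
      (t - t') * (Real.log (t / w) + 1) + (t' - s) * (Real.log t - Real.log t') := by
    have hw0 := (hγ.trans_le hw.1).ne'
    rw [lossGrad, lossGrad, Real.log_div (hγ.trans_le ht.1).ne' hw0,
      Real.log_div (hγ.trans_le ht'.1).ne' hw0]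
    ring
  have h1 : |t' - s| ≤ 1 := abs_le.2 ⟨by linarith [ht'.1, hs.2], by linarith [ht'.2, hs.1]⟩
  have h2 : |Real.log (t / w) + 1| ≤ 1 / γ + 1 :=
    (abs_add_le _ _).trans (by simpa using abs_log_div_le hγ ht hw)
  have h3 := abs_log_sub_log_le hγ ht.1 ht'.1
  rw [e]
  calc _ ≤ |t - t'| * |Real.log (t / w) + 1| + |t' - s| * |Real.log t - Real.log t'| := by
        rw [← abs_mul, ← abs_mul]; exact abs_add_le _ _
    _ ≤ |t - t'| * (1 / γ + 1) + 1 * (|t - t'| / γ) := by gcongr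
    _ = _ := by ring

/-- The tangent line inequality for the convex loss `t ↦ t log (t / w)`. -/
theorem mul_log_div_sub_le (ha : 0 < a) (hb : 0 < b) (hw : 0 < w) :
    a * Real.log (a / w) - b * Real.log (b / w) ≤ lossGrad b w a := by
  have h := Real.log_le_sub_one_of_pos (div_pos ha hb)
  have h1 : b * Real.log (a / b) ≤ b * (a / b - 1) := by gcongr
  have h2 : b * (a / b - 1) = a - b := by field_simp
  rw [Real.log_div ha.ne' hb.ne'] at h1
  rw [lossGrad, Real.log_div ha.ne' hw.ne', Real.log_div hb.ne' hw.ne']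
  linarith

/-- First order optimality along a segment for the empirical loss `∑ z log (z / w)`. -/
theorem sum_lossGrad_nonpos {n : ℕ} {z s w : Fin n → ℝ} (hz : ∀ k, 0 < z k) (hs : ∀ k, 0 < s k)
    (hw : ∀ k, 0 < w k)
    (hmin : ∀ r : ℝ, 0 < r → r ≤ 1 → ∑ k, z k * Real.log (z k / w k) ≤
      ∑ k, ((1 - r) * z k + r * s k) * Real.log (((1 - r) * z k + r * s k) / w k)) :
    ∑ k, lossGrad (s k) (w k) (z k) ≤ 0 := by
  -- The tangent is taken at the moving point of the segment, so minimality gives the sign after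
  -- division by `r`; letting `r → 0` then needs only continuity of `log`.
  have key : ∀ r : ℝ, 0 < r → r ≤ 1 →
      ∑ k, (z k - s k) * (Real.log (((1 - r) * z k + r * s k) / w k) + 1) ≤ 0 := by
    intro r hr hr1
    have hpos : ∀ k, 0 < (1 - r) * z k + r * s k := fun k => by
      have := mul_nonneg (sub_nonneg.2 hr1) (hz k).le
      have := mul_pos hr (hs k)
      linarith
    have h1 := hmin r hr hr1
    have h2 := Finset.sum_le_sum fun k (_ : k ∈ Finset.univ) =>
      mul_log_div_sub_le (hpos k) (hz k) (hw k)
    rw [Finset.sum_sub_distrib] at h2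
    have e : ∑ k, lossGrad (z k) (w k) ((1 - r) * z k + r * s k) =
        -r * ∑ k, (z k - s k) * (Real.log (((1 - r) * z k + r * s k) / w k) + 1) := by
      rw [Finset.mul_sum]
      exact Finset.sum_congr rfl fun k _ => by rw [lossGrad]; ring
    rw [e] at h2
    by_contra hc
    nlinarith [mul_pos hr (not_le.1 hc)]
  have hlim : Tendsto (fun r : ℝ => ∑ k, (z k - s k) *
      (Real.log (((1 - r) * z k + r * s k) / w k) + 1)) (𝓝[>] 0)
      (𝓝 (∑ k, lossGrad (s k) (w k) (z k))) := by
    refine tendsto_finsetSum _ fun k _ => ?_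
    have hc : ContinuousAt (fun r : ℝ => (z k - s k) *
        (Real.log (((1 - r) * z k + r * s k) / w k) + 1)) 0 := by
      refine continuousAt_const.mul ((ContinuousAt.log (by fun_prop) ?_).add continuousAt_const)
      simpa using ⟨(hz k).ne', (hw k).ne'⟩
    have := hc.tendsto.mono_left (nhdsWithin_le_nhds (s := Set.Ioi 0))
    simpa [lossGrad] using this
  refine le_of_tendsto hlim ?_
  filter_upwards [Ioc_mem_nhdsGT (zero_lt_one' ℝ)] with r hr using key r hr.1 hr.2

end RealInequalities

/-! ### Divergences between models. -/

section Models

variable {d : ℕ} {μ : Measure (Vec d)} {X : Set (Vec d)} {γ : ℝ} {F G H : Vec d → ℝ}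

theorem IsModel.mem_Icc (hF : IsModel μ X γ F) {x : Vec d} (hx : x ∈ X) :
    F x ∈ Set.Icc γ 1 := ⟨hF.lower x hx, hF.upper x hx⟩

theorem IsModel.measure_ne_zero (hF : IsModel μ X γ F) : μ X ≠ 0 := fun h => by
  have := hF.normalized
  rw [Measure.restrict_eq_zero.2 h, integral_zero_measure] at this
  exact zero_ne_one this

/-- Integrating `γ ≤ F` against total mass `1` forces the reference measure to be finite on `X`,
with mass at most `1/γ`. -/
theorem IsModel.mul_measure_le_one (hF : IsModel μ X γ F) (hγ : 0 < γ) (hX : MeasurableSet X) :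
    ENNReal.ofReal γ * μ X ≤ 1 := by
  have hint : Integrable F (μ.restrict X) := by
    -- A non-integrable function has integral `0` by convention, contradicting the normalization to
    -- `1`.
    by_contra h
    have := hF.normalized
    rw [integral_undef h] at this
    exact zero_ne_one this
  have hnn : 0 ≤ᵐ[μ.restrict X] F :=
    (ae_restrict_iff' hX).2 (ae_of_all _ fun x hx => hγ.le.trans (hF.lower x hx))
  have h := ofReal_integral_eq_lintegral_ofReal hint hnn
  rw [hF.normalized, ENNReal.ofReal_one] at h
  rw [h, ← setLIntegral_const]
  exact setLIntegral_mono' hX fun x hx => ENNReal.ofReal_le_ofReal (hF.lower x hx)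

theorem IsModel.measure_ne_top (hF : IsModel μ X γ F) (hγ : 0 < γ) (hX : MeasurableSet X) :
    μ X ≠ ⊤ := fun h => by
  have := hF.mul_measure_le_one hγ hX
  rw [h, ENNReal.mul_top (by simpa using hγ)] at this
  simp at this

theorem IsModel.measureReal_le (hF : IsModel μ X γ F) (hγ : 0 < γ) (hX : MeasurableSet X) :
    μ.real X ≤ 1 / γ := by
  have := ENNReal.toReal_mono ENNReal.one_ne_top (hF.mul_measure_le_one hγ hX)
  rw [ENNReal.toReal_mul, ENNReal.toReal_ofReal hγ.le, ENNReal.toReal_one] at this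
  rwa [le_div_iff₀ hγ, mul_comm]

theorem integrableOn_of_abs_le (hX : MeasurableSet X) (hμ : μ X ≠ ⊤) (hF : Measurable F) {B : ℝ}
    (hB : ∀ x ∈ X, |F x| ≤ B) : IntegrableOn F X μ := by
  have : IsFiniteMeasure (μ.restrict X) := isFiniteMeasure_restrict.2 hμ
  exact Integrable.of_bound hF.aestronglyMeasurable B
    ((ae_restrict_iff' hX).2 (ae_of_all _ hB))

theorem IsModel.abs_le_one (hF : IsModel μ X γ F) (hγ : 0 < γ) {x : Vec d} (hx : x ∈ X) :
    |F x| ≤ 1 :=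
  abs_le.2 ⟨by linarith [hF.lower x hx], hF.upper x hx⟩

theorem IsModel.abs_sub_le_one (hF : IsModel μ X γ F) (hG : IsModel μ X γ G) (hγ : 0 < γ)
    {x : Vec d} (hx : x ∈ X) : |F x - G x| ≤ 1 :=
  abs_le.2 ⟨by linarith [hF.lower x hx, hG.upper x hx], by linarith [hF.upper x hx, hG.lower x hx]⟩

theorem IsModel.integrableOn (hF : IsModel μ X γ F) (hγ : 0 < γ) (hX : MeasurableSet X) :
    IntegrableOn F X μ :=
  integrableOn_of_abs_le hX (hF.measure_ne_top hγ hX) hF.measurable fun _ hx => hF.abs_le_one hγ hx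

theorem IsModel.integrableOn_mul_log (hF : IsModel μ X γ F) (hG : IsModel μ X γ G)
    (hH : Measurable H) (hH1 : ∀ x ∈ X, |H x| ≤ 1) (hγ : 0 < γ) (hX : MeasurableSet X) :
    IntegrableOn (fun x => H x * Real.log (F x / G x)) X μ := by
  have hFm := hF.measurable
  have hGm := hG.measurable
  refine integrableOn_of_abs_le (B := 1 * (1 / γ)) hX (hF.measure_ne_top hγ hX) (by fun_prop)
    fun x hx => ?_
  rw [abs_mul]
  gcongr
  · exact hH1 x hx
  · exact abs_log_div_le hγ (hF.mem_Icc hx) (hG.mem_Icc hx)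

/-- A Pinsker type inequality for the output distribution divergence. -/
theorem integral_abs_sub_le (hF : IsModel μ X γ F) (hG : IsModel μ X γ G) (hγ : 0 < γ)
    (hX : MeasurableSet X) :
    ∫ x in X, |F x - G x| ∂μ ≤ 2 / γ * √(outputDiv μ X F G) := by
  have hμ := hF.measure_ne_top hγ hX
  have hFm := hF.measurable
  have hGm := hG.measurable
  have i0 : IntegrableOn (fun x => |F x - G x|) X μ :=
    integrableOn_of_abs_le (B := 1) hX hμ (by fun_prop) fun x hx => by
      rw [abs_abs]; exact hF.abs_sub_le_one hG hγ hx
  have i1 : IntegrableOn (fun x => (F x - G x) ^ 2) X μ :=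
    integrableOn_of_abs_le (B := 1) hX hμ (by fun_prop) fun x hx => by
      rw [abs_pow]; exact pow_le_one₀ (abs_nonneg _) (hF.abs_sub_le_one hG hγ hx)
  have i2 := hF.integrableOn_mul_log hG hFm (fun _ hx => hF.abs_le_one hγ hx) hγ hX
  have iF := hF.integrableOn hγ hX
  have iG := hG.integrableOn hγ hX
  -- The linear terms of the pointwise bound cancel because both models integrate to `1`.
  have h1 : (∫ x in X, (F x - G x) ^ 2 ∂μ) / 4 ≤ outputDiv μ X F G := by
    have := setIntegral_mono_on (i1.div_const 4) ((i2.sub iF).add iG) hX fun x hx =>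
      sq_sub_div_four_le (hγ.trans_le (hF.lower x hx)) (hγ.trans_le (hG.lower x hx))
        (hF.upper x hx) (hG.upper x hx)
    rw [integral_div] at this
    refine this.trans (le_of_eq ?_)
    have i3 : IntegrableOn (fun x => F x * Real.log (F x / G x) - F x) X μ := i2.sub iF
    change ∫ x in X, (F x * Real.log (F x / G x) - F x + G x) ∂μ = _
    rw [integral_add i3 iG, integral_sub i2 iF, hF.normalized, hG.normalized, outputDiv]
    ring
  have hM : 0 < μ.real X := ENNReal.toReal_pos hF.measure_ne_zero hμ
  set I := ∫ x in X, |F x - G x| ∂μ with I_def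
  -- Cauchy–Schwarz, from nonnegativity of the variance of `|F - G|` about its mean `m`.
  have h2 : I ^ 2 ≤ μ.real X * ∫ x in X, (F x - G x) ^ 2 ∂μ := by
    set m := I / μ.real X with m_def
    have hsq : 0 ≤ ∫ x in X, (|F x - G x| - m) ^ 2 ∂μ := integral_nonneg fun x => sq_nonneg _
    have hexp : ∫ x in X, (|F x - G x| - m) ^ 2 ∂μ =
        ∫ x in X, (F x - G x) ^ 2 ∂μ - 2 * m * I + μ.real X * m ^ 2 := by
      have hpt : ∀ x, (|F x - G x| - m) ^ 2 = (F x - G x) ^ 2 - 2 * m * |F x - G x| + m ^ 2 :=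
        fun x => by rw [← sq_abs (F x - G x)]; ring
      have : IsFiniteMeasure (μ.restrict X) := isFiniteMeasure_restrict.2 hμ
      have i4 : IntegrableOn (fun x => 2 * m * |F x - G x|) X μ := i0.const_mul _
      have i5 : IntegrableOn (fun x => (F x - G x) ^ 2 - 2 * m * |F x - G x|) X μ := i1.sub i4
      rw [integral_congr_ae (ae_of_all _ hpt), integral_add i5 (integrable_const _),
        integral_sub i1 i4, integral_const_mul, setIntegral_const, smul_eq_mul]
    rw [hexp] at hsq
    have e : μ.real X * (∫ x in X, (F x - G x) ^ 2 ∂μ - 2 * m * I + μ.real X * m ^ 2) =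
        μ.real X * (∫ x in X, (F x - G x) ^ 2 ∂μ) - I ^ 2 := by
      rw [m_def]; field_simp; ring
    have := mul_nonneg hM.le hsq
    linarith
  have hsq0 : 0 ≤ ∫ x in X, (F x - G x) ^ 2 ∂μ := integral_nonneg fun x => sq_nonneg _
  have hdiv : 0 ≤ outputDiv μ X F G := by linarith
  -- Allows `1/γ` to be weakened to `1/γ²`, so that the right side becomes the square of `2/γ * √d`.
  have hγ1 : 1 ≤ 1 / γ := by
    obtain ⟨x, hx⟩ : X.Nonempty := nonempty_of_measure_ne_zero hF.measure_ne_zero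
    rw [le_div_iff₀ hγ]
    linarith [hF.lower x hx, hF.upper x hx]
  refine abs_le_of_sq_le_sq' ?_ (by positivity) |>.2
  rw [mul_pow, Real.sq_sqrt hdiv]
  have hMγ := hF.measureReal_le hγ hX
  calc I ^ 2 ≤ μ.real X * ∫ x in X, (F x - G x) ^ 2 ∂μ := h2
    _ ≤ (1 / γ) * (4 * outputDiv μ X F G) := by gcongr; linarith
    _ ≤ (1 / γ * (1 / γ)) * (4 * outputDiv μ X F G) := by
        gcongr; exact le_mul_of_one_le_left (by positivity) hγ1
    _ = _ := by ring

/-- The defect in the Pythagorean inequality is the pairing of `F - G` with `log (F / H)`. -/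
theorem outputDiv_add_sub (hF : IsModel μ X γ F) (hG : IsModel μ X γ G) (hH : IsModel μ X γ H)
    (hγ : 0 < γ) (hX : MeasurableSet X) :
    outputDiv μ X G F + outputDiv μ X F H - outputDiv μ X G H =
      ∫ x in X, (F x - G x) * Real.log (F x / H x) ∂μ := by
  have iGF := hG.integrableOn_mul_log hF hG.measurable (fun _ hx => hG.abs_le_one hγ hx) hγ hX
  have iFH := hF.integrableOn_mul_log hH hF.measurable (fun _ hx => hF.abs_le_one hγ hx) hγ hX
  have iGH := hG.integrableOn_mul_log hH hG.measurable (fun _ hx => hG.abs_le_one hγ hx) hγ hX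
  have iadd : IntegrableOn
      (fun x => G x * Real.log (G x / F x) + F x * Real.log (F x / H x)) X μ := iGF.add iFH
  rw [outputDiv, outputDiv, outputDiv, ← integral_add iGF iFH, ← integral_sub iadd iGH]
  refine setIntegral_congr_fun hX fun x hx => ?_
  have h1 := (hγ.trans_le (hF.lower x hx)).ne'
  have h2 := (hγ.trans_le (hG.lower x hx)).ne'
  have h3 := (hγ.trans_le (hH.lower x hx)).ne'
  simp only [Real.log_div, h1, h2, h3, ne_eq, not_false_eq_true]
  ring

theorem integrableOn_lossGrad {S : Vec d → ℝ} (hF : IsModel μ X γ F) (hS : IsModel μ X γ S)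
    (hH : IsModel μ X γ H) (hγ : 0 < γ) (hX : MeasurableSet X) :
    IntegrableOn (fun x => lossGrad (S x) (H x) (F x)) X μ := by
  have hFm := hF.measurable
  have hSm := hS.measurable
  have hHm := hH.measurable
  exact integrableOn_of_abs_le hX (hF.measure_ne_top hγ hX) (by unfold lossGrad; fun_prop)
    fun x hx => abs_lossGrad_le hγ (hS.mem_Icc hx) (hH.mem_Icc hx) (hF.mem_Icc hx)

/-- Replacing the ground truth by an intermediate model `S` costs a multiple of `√(d(G, S))`. -/
theorem outputDiv_le_add_integral_lossGrad {S : Vec d → ℝ} (hF : IsModel μ X γ F)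
    (hG : IsModel μ X γ G) (hH : IsModel μ X γ H) (hS : IsModel μ X γ S) (hγ : 0 < γ)
    (hX : MeasurableSet X) :
    outputDiv μ X G F ≤ outputDiv μ X G H - outputDiv μ X F H +
      2 / γ ^ 2 * √(outputDiv μ X G S) + ∫ x in X, lossGrad (S x) (H x) (F x) ∂μ := by
  have hμ := hF.measure_ne_top hγ hX
  have iFS : IntegrableOn (fun x => (F x - S x) * Real.log (F x / H x)) X μ := hF.integrableOn_mul_log hH (hF.measurable.sub hS.measurable)
    (fun _ hx => hF.abs_sub_le_one hS hγ hx) hγ hX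
  have iSG : IntegrableOn (fun x => (S x - G x) * Real.log (F x / H x)) X μ := hF.integrableOn_mul_log hH (hS.measurable.sub hG.measurable)
    (fun _ hx => hS.abs_sub_le_one hG hγ hx) hγ hX
  have iF := hF.integrableOn hγ hX
  have iS := hS.integrableOn hγ hX
  have isub : IntegrableOn (fun x => F x - S x) X μ := iF.sub iS
  -- The `+ 1` in `lossGrad` contributes `∫ (F - S) = 0`.
  have h1 : ∫ x in X, lossGrad (S x) (H x) (F x) ∂μ =
      ∫ x in X, (F x - S x) * Real.log (F x / H x) ∂μ := by
    have : ∀ x, lossGrad (S x) (H x) (F x) =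
        (F x - S x) * Real.log (F x / H x) + (F x - S x) := fun x => by rw [lossGrad]; ring
    simp_rw [this]
    rw [integral_add iFS isub, integral_sub iF iS, hF.normalized, hS.normalized]
    ring
  have h2 : ∫ x in X, (F x - G x) * Real.log (F x / H x) ∂μ =
      ∫ x in X, (F x - S x) * Real.log (F x / H x) ∂μ +
        ∫ x in X, (S x - G x) * Real.log (F x / H x) ∂μ := by
    rw [← integral_add iFS iSG]
    congr 1
    ext x
    ring
  have h3 : ∫ x in X, (S x - G x) * Real.log (F x / H x) ∂μ ≤
      2 / γ ^ 2 * √(outputDiv μ X G S) := by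
    have iabs : IntegrableOn (fun x => |G x - S x|) X μ :=
      integrableOn_of_abs_le (B := 1) hX hμ
        (by have := hG.measurable; have := hS.measurable; fun_prop) fun x hx => by
        rw [abs_abs]; exact hG.abs_sub_le_one hS hγ hx
    calc _ ≤ ∫ x in X, 1 / γ * |G x - S x| ∂μ := by
          refine setIntegral_mono_on iSG (iabs.const_mul _) hX fun x hx => ?_
          refine (le_abs_self _).trans ?_
          rw [abs_mul, mul_comm, abs_sub_comm]
          gcongr
          exact abs_log_div_le hγ (hF.mem_Icc hx) (hH.mem_Icc hx)
      _ = 1 / γ * ∫ x in X, |G x - S x| ∂μ := integral_const_mul _ _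
      _ ≤ 1 / γ * (2 / γ * √(outputDiv μ X G S)) := by
          gcongr; exact integral_abs_sub_le hG hS hγ hX
      _ = _ := by ring
  have h4 := outputDiv_add_sub hF hG hH hγ hX
  linarith

end Models

end WeakToStrong

/-! ### Sampling from `X` and generalization over the class. -/

namespace WeakToStrong

section Sampling

variable {d : ℕ} {μ : Measure (Vec d)} {X : Set (Vec d)}

theorem isProbabilityMeasure_dataDist (h0 : μ X ≠ 0) (h1 : μ X ≠ ⊤) :
    IsProbabilityMeasure (dataDist μ X) :=
  ProbabilityTheory.cond_isProbabilityMeasure_of_finite h0 h1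

/-- Models are controlled only on `X`, whereas the deviation bounds ask for bounds everywhere; the
indicator reconciles the two. -/
theorem setIntegral_eq_mul_integral_dataDist (hX : MeasurableSet X) (h0 : μ X ≠ 0)
    (h1 : μ X ≠ ⊤) (f : Vec d → ℝ) :
    ∫ x in X, f x ∂μ = μ.real X * ∫ x, X.indicator f x ∂(dataDist μ X) := by
  rw [dataDist, ProbabilityTheory.cond, integral_smul_measure, integral_indicator hX,
    Measure.restrict_restrict hX, Set.inter_self, ENNReal.toReal_inv, smul_eq_mul, ← mul_assoc,
    Measure.real, mul_inv_cancel₀ (ENNReal.toReal_pos h0 h1).ne', one_mul]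

theorem ae_sampleLaw_mem (hX : MeasurableSet X) (h0 : μ X ≠ 0) (h1 : μ X ≠ ⊤) (n : ℕ) :
    ∀ᵐ x ∂(sampleLaw μ X n), ∀ k, x k ∈ X := by
  have := isProbabilityMeasure_dataDist h0 h1
  refine ae_all_iff.2 fun k => ?_
  have hae : ∀ᵐ y ∂(dataDist μ X), y ∈ X := by
    unfold dataDist ProbabilityTheory.cond
    exact Measure.ae_smul_measure (ae_restrict_mem hX) _
  exact (measurePreserving_eval (fun _ : Fin n => dataDist μ X) k).quasiMeasurePreserving.ae hae

theorem rademacher_le_sqrt {V : Set (Vec d → ℝ)} (hC : complexityConst μ X V ≠ ⊤) {n : ℕ}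
    (hn : 0 < n) : rademacher μ X V n ≤ √((complexityConst μ X V).toReal / n) := by
  have hn' : (0 : ℝ) < n := by exact_mod_cast hn
  have h := ENNReal.toReal_mono hC
    (le_iSup (fun n : ℕ => ENNReal.ofReal ((n : ℝ) * rademacher μ X V n ^ 2)) n)
  rw [ENNReal.toReal_ofReal (by positivity)] at h
  refine Real.le_sqrt_of_sq_le ?_
  rw [le_div_iff₀ hn', mul_comm]
  exact h

/-- The supremum in the Rademacher complexity can be taken over a dense subclass. -/
theorem iSup_eq_iSup_of_pointwise_limit {V D : Set (Vec d → ℝ)} (hDV : D ⊆ V) (hV : V.Nonempty)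
    (hVB : ∀ v ∈ V, ∀ x ∈ X, |v x| ≤ 1)
    (hlim : ∀ v ∈ V, ∃ u : ℕ → Vec d → ℝ,
      (∀ j, u j ∈ D) ∧ ∀ x ∈ X, Tendsto (fun j => u j x) atTop (𝓝 (v x)))
    {n : ℕ} (hn : 0 < n) (σ : Fin n → Bool) {x : Fin n → Vec d} (hx : ∀ k, x k ∈ X) :
    ⨆ v : V, (n : ℝ)⁻¹ * ∑ k, sign (σ k) * v.1 (x k) =
      signedSup (fun (v : D) => X.indicator v.1) σ x := by
  have hind : ∀ (v : D) k, X.indicator v.1 (x k) = v.1 (x k) := fun v k =>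
    Set.indicator_of_mem (hx k) _
  have hbd : ∀ v : V, |(n : ℝ)⁻¹ * ∑ k, sign (σ k) * v.1 (x k)| ≤ 1 := fun v =>
    abs_avg_le hn (fun k => abs_sign _) fun k => hVB _ v.2 _ (hx k)
  have : Nonempty V := hV.to_subtype
  have : Nonempty D := by
    obtain ⟨v, hv⟩ := hV
    obtain ⟨u, hu, -⟩ := hlim v hv
    exact ⟨⟨u 0, hu 0⟩⟩
  unfold signedSup
  simp only [hind]
  have hbdD : BddAbove (Set.range fun v : D => (n : ℝ)⁻¹ * ∑ k, sign (σ k) * v.1 (x k)) :=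
    bddAbove_range_of_abs_le fun v => hbd ⟨v.1, hDV v.2⟩
  apply le_antisymm
  · refine ciSup_le fun v => ?_
    obtain ⟨u, hu, hul⟩ := hlim v.1 v.2
    have ht : Tendsto (fun j => (n : ℝ)⁻¹ * ∑ k, sign (σ k) * u j (x k)) atTop
        (𝓝 ((n : ℝ)⁻¹ * ∑ k, sign (σ k) * v.1 (x k))) :=
      (tendsto_finsetSum _ fun k _ => (hul _ (hx k)).const_mul _).const_mul _
    exact le_of_tendsto' ht fun j => le_ciSup hbdD ⟨u j, hu j⟩
  · exact ciSup_le fun v => le_ciSup (bddAbove_range_of_abs_le hbd) (⟨v.1, hDV v.2⟩ : V)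

theorem integral_empRademacher_eq_rademacher {V D : Set (Vec d → ℝ)} (hDV : D ⊆ V)
    (hV : V.Nonempty) (hVB : ∀ v ∈ V, ∀ x ∈ X, |v x| ≤ 1)
    (hlim : ∀ v ∈ V, ∃ u : ℕ → Vec d → ℝ,
      (∀ j, u j ∈ D) ∧ ∀ x ∈ X, Tendsto (fun j => u j x) atTop (𝓝 (v x)))
    (hX : MeasurableSet X) (h0 : μ X ≠ 0) (h1 : μ X ≠ ⊤) {n : ℕ} (hn : 0 < n) :
    ∫ x, empRademacher (fun v : D => X.indicator v.1) x ∂(sampleLaw μ X n) =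
      rademacher μ X V n := by
  refine integral_congr_ae ?_
  filter_upwards [ae_sampleLaw_mem hX h0 h1 n] with x hx
  rw [empRademacher]
  congr 1
  exact Finset.sum_congr rfl fun σ _ =>
    (iSup_eq_iSup_of_pointwise_limit hDV hV hVB hlim hn σ hx).symm

end Sampling

section Generalization

variable {d : ℕ} {μ : Measure (Vec d)} {X : Set (Vec d)} {γ : ℝ} {H S : Vec d → ℝ}
  {V : Set (Vec d → ℝ)}

/-- The integral of `lossGrad` is continuous along pointwise convergent sequences of models. -/
theorem tendsto_setIntegral_lossGrad (hγ : 0 < γ) (hX : MeasurableSet X)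
    (hS : IsModel μ X γ S) (hH : IsModel μ X γ H) {v : Vec d → ℝ} (hv : IsModel μ X γ v)
    {u : ℕ → Vec d → ℝ} (hu : ∀ j, IsModel μ X γ (u j))
    (hlim : ∀ x ∈ X, Tendsto (fun j => u j x) atTop (𝓝 (v x))) :
    (∀ x ∈ X, Tendsto (fun j => lossGrad (S x) (H x) (u j x)) atTop
      (𝓝 (lossGrad (S x) (H x) (v x)))) ∧
    Tendsto (fun j => ∫ x in X, lossGrad (S x) (H x) (u j x) ∂μ) atTop
      (𝓝 (∫ x in X, lossGrad (S x) (H x) (v x) ∂μ)) := by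
  have hpt : ∀ x ∈ X, Tendsto (fun j => lossGrad (S x) (H x) (u j x)) atTop
      (𝓝 (lossGrad (S x) (H x) (v x))) := fun x hx => by
    have h1 := hlim x hx
    have h2 : v x / H x ≠ 0 :=
      (div_pos (hγ.trans_le (hv.lower x hx)) (hγ.trans_le (hH.lower x hx))).ne'
    exact (h1.sub_const _).mul (((h1.div_const _).log h2).add_const _)
  refine ⟨hpt, ?_⟩
  have : IsFiniteMeasure (μ.restrict X) := isFiniteMeasure_restrict.2 (hv.measure_ne_top hγ hX)
  refine tendsto_integral_of_dominated_convergence (fun _ => 1 / γ + 1)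
    (fun j => (integrableOn_lossGrad (hu j) hS hH hγ hX).aestronglyMeasurable)
    (integrable_const _) (fun j => ?_) ((ae_restrict_iff' hX).2 (ae_of_all _ hpt))
  exact (ae_restrict_iff' hX).2 (ae_of_all _ fun x hx =>
    abs_lossGrad_le hγ (hS.mem_Icc hx) (hH.mem_Icc hx) ((hu j).mem_Icc hx))

/-- A uniform one-sided generalization bound for `lossGrad` over a pointwise measurable class of
models. -/
theorem exists_event_setIntegral_lossGrad_le (hγ : 0 < γ) (hX : MeasurableSet X)
    (hS : IsModel μ X γ S) (hH : IsModel μ X γ H) (hV : ∀ v ∈ V, IsModel μ X γ v)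
    (hVne : V.Nonempty) (hVm : PointwiseMeasurableOn X V) {n : ℕ} (hn : 0 < n) {s T : ℝ}
    (hs : 0 ≤ s) (hT : 2 * ((2 / γ + 1) * rademacher μ X V n) + s ≤ T) :
    ∃ A : Set (Fin n → Vec d), MeasurableSet A ∧
      ENNReal.ofReal (1 - Real.exp (-(n * s ^ 2) / (2 * (1 / γ + 1) ^ 2))) ≤ sampleLaw μ X n A ∧
      ∀ x ∈ A, (∀ k, x k ∈ X) ∧ ∀ v ∈ V,
        ∫ y in X, lossGrad (S y) (H y) (v y) ∂μ ≤
          μ.real X * (T + (n : ℝ)⁻¹ * ∑ k, lossGrad (S (x k)) (H (x k)) (v (x k))) := by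
  obtain ⟨D, hDV, hDc, hlim⟩ := hVm
  have h0 := hS.measure_ne_zero
  have h1 := hS.measure_ne_top hγ hX
  have hP := isProbabilityMeasure_dataDist h0 h1
  have hQ : IsProbabilityMeasure (sampleLaw μ X n) := by unfold sampleLaw; infer_instance
  have hVB : ∀ v ∈ V, ∀ x ∈ X, |v x| ≤ 1 := fun v hv x hx => (hV v hv).abs_le_one hγ hx
  have : Countable D := hDc.to_subtype
  have : Nonempty D := by
    obtain ⟨v, hv⟩ := hVne
    obtain ⟨u, hu, -⟩ := hlim v hv
    exact ⟨⟨u 0, hu 0⟩⟩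
  have hD : ∀ v : D, IsModel μ X γ v.1 := fun v => hV _ (hDV v.2)
  set B : ℝ := 1 / γ + 1 with B_def
  have hB0 : 0 < B := by positivity
  set g : D → Vec d → ℝ := fun v => X.indicator fun x => lossGrad (S x) (H x) (v.1 x) with g_def
  have hgm : ∀ v, Measurable (g v) := fun v => by
    have := (hD v).measurable
    have := hS.measurable
    have := hH.measurable
    refine Measurable.indicator ?_ hX
    unfold lossGrad
    fun_prop
  have hgB : ∀ v x, |g v x| ≤ B := fun v x => by
    by_cases hx : x ∈ X
    · simp only [g_def, Set.indicator_of_mem hx]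
      exact abs_lossGrad_le hγ (hS.mem_Icc hx) (hH.mem_Icc hx) ((hD v).mem_Icc hx)
    · simp only [g_def, Set.indicator_of_notMem hx, abs_zero]
      exact hB0.le
  have hvB : ∀ (v : D) x, |X.indicator v.1 x| ≤ 1 := fun v x => by
    by_cases hx : x ∈ X
    · rw [Set.indicator_of_mem hx]; exact hVB _ (hDV v.2) x hx
    · rw [Set.indicator_of_notMem hx, abs_zero]; exact zero_le_one
  have hgL : ∀ (i j : D) x,
      |g i x - g j x| ≤ (2 / γ + 1) * |X.indicator i.1 x - X.indicator j.1 x| := fun i j x => by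
    by_cases hx : x ∈ X
    · simp only [g_def, Set.indicator_of_mem hx]
      exact abs_lossGrad_sub_le hγ (hS.mem_Icc hx) (hH.mem_Icc hx) ((hD i).mem_Icc hx)
        ((hD j).mem_Icc hx)
    · simp [g_def, Set.indicator_of_notMem hx]
  have hemp : ∀ {w : D → Vec d → ℝ} {C : ℝ}, (∀ v, Measurable (w v)) → (∀ v x, |w v x| ≤ C) →
      Integrable (fun x : Fin n → Vec d => empRademacher w x) (sampleLaw μ X n) :=
    fun hm hC => (integrable_finsetSum _ fun σ _ => integrable_of_abs_le
      (measurable_signedSup hm σ) (abs_signedSup_le hn hC σ)).const_mul _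
  have hR : ∫ x : Fin n → Vec d, empRademacher g x ∂(sampleLaw μ X n) ≤
      (2 / γ + 1) * rademacher μ X V n := by
    rw [← integral_empRademacher_eq_rademacher hDV hVne hVB hlim hX h0 h1 hn,
      ← integral_const_mul]
    refine integral_mono (hemp hgm hgB) ((hemp (fun v => (hD v).measurable.indicator hX)
      hvB).const_mul _) fun x => ?_
    exact empRademacher_contraction hn (by positivity) hgB hvB hgL x
  have hdev := measureReal_supDeviation_ge_le (P := dataDist μ X) hn hgm hgB hB0 hs
  set Q := Measure.pi fun _ : Fin n => dataDist μ X with Q_def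
  have hbad : MeasurableSet {x : Fin n → Vec d | T ≤ supDeviation (dataDist μ X) g x} :=
    measurableSet_le measurable_const (measurable_supDeviation hgm)
  have hXn : MeasurableSet {x : Fin n → Vec d | ∀ k, x k ∈ X} := by
    have : {x : Fin n → Vec d | ∀ k, x k ∈ X} = Set.univ.pi fun _ => X := by ext; simp
    rw [this]
    exact MeasurableSet.univ_pi fun _ => hX
  have hbadle : Q.real {x : Fin n → Vec d | T ≤ supDeviation (dataDist μ X) g x} ≤
      Real.exp (-(n * s ^ 2) / (2 * B ^ 2)) := by
    refine (measureReal_mono fun x hx => ?_).trans hdev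
    simp only [Set.mem_ofPred_eq] at hx ⊢
    change _ ≤ (2 / γ + 1) * rademacher μ X V n at hR
    rw [sampleLaw] at hR
    linarith
  -- Intersecting with samples lying in `X` costs no probability and removes the indicators.
  refine ⟨{x | T ≤ supDeviation (dataDist μ X) g x}ᶜ ∩ {x | ∀ k, x k ∈ X},
    hbad.compl.inter hXn, ?_, ?_⟩
  · change _ ≤ Q _
    have hae : ∀ᵐ x ∂Q, x ∈ {x : Fin n → Vec d | ∀ k, x k ∈ X} := ae_sampleLaw_mem hX h0 h1 n
    rw [Set.inter_comm, Measure.measure_inter_eq_of_ae hae,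
      ← ofReal_measureReal, probReal_compl_eq_one_sub hbad]
    gcongr
  · rintro x ⟨hx, hxX⟩
    refine ⟨hxX, ?_⟩
    have hxT : supDeviation (dataDist μ X) g x ≤ T := by
      simp only [Set.mem_compl_iff, Set.mem_ofPred_eq, not_le] at hx
      exact hx.le
    have hcount : ∀ v ∈ D, ∫ y in X, lossGrad (S y) (H y) (v y) ∂μ ≤
        μ.real X * (T + (n : ℝ)⁻¹ * ∑ k, lossGrad (S (x k)) (H (x k)) (v (x k))) := by
      intro v hv
      rw [setIntegral_eq_mul_integral_dataDist hX h0 h1]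
      have hle := (le_ciSup (bddAbove_range_of_abs_le
        (abs_integral_sub_avg_le (P := dataDist μ X) hn hgB x)) ⟨v, hv⟩).trans hxT
      have hsum : ∑ k, g ⟨v, hv⟩ (x k) =
          ∑ k, lossGrad (S (x k)) (H (x k)) (v (x k)) :=
        Finset.sum_congr rfl fun k _ => Set.indicator_of_mem (hxX k) _
      rw [hsum] at hle
      exact mul_le_mul_of_nonneg_left (by linarith) measureReal_nonneg
    -- The bound holds on the countable `D` and both sides converge along a sequence in `D` tending
    -- to `v`, so it passes to all of `V` on the same event.
    intro v hv
    obtain ⟨u, hu, hul⟩ := hlim v hv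
    obtain ⟨hpt, hint⟩ := tendsto_setIntegral_lossGrad hγ hX hS hH (hV v hv)
      (fun j => hD ⟨u j, hu j⟩) hul
    refine le_of_tendsto_of_tendsto' hint ?_ fun j => hcount (u j) (hu j)
    exact ((tendsto_finsetSum _ fun k _ => hpt _ (hxX k)).const_mul _ |>.const_add _).const_mul _

end Generalization

end WeakToStrong

/-! ### Assembly of the bound. -/

theorem theorem4 (γ : ℝ) (hγ : 0 < γ) :
    -- the constants hidden in the three `O(·)`; they depend on `γ` only
    ∃ K₁ K₂ K₃ : ℝ, 0 < K₁ ∧ 0 < K₂ ∧ 0 < K₃ ∧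
      ∀ (d dstar dw ds : ℕ) (X : Set (WeakToStrong.Vec d)) (_ : MeasurableSet X)
        (μ : MeasureTheory.Measure (WeakToStrong.Vec d))
        -- ground truth, weak model, strong representation and strong hypothesis class
        (hstar : WeakToStrong.Vec d → WeakToStrong.Vec dstar)
        (fstar : WeakToStrong.Vec dstar → ℝ)
        (hw : WeakToStrong.Vec d → WeakToStrong.Vec dw)
        (fw : WeakToStrong.Vec dw → ℝ)
        (hs : WeakToStrong.Vec d → WeakToStrong.Vec ds)
        (𝓕s : Set (WeakToStrong.Vec ds → ℝ))
        (_ : WeakToStrong.IsModel μ X γ (fstar ∘ hstar))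
        (_ : WeakToStrong.IsModel μ X γ (fw ∘ hw))
        (_ : ∀ f ∈ 𝓕s, WeakToStrong.IsModel μ X γ (f ∘ hs))
        (_ : Convex ℝ 𝓕s)
        (_ : WeakToStrong.PointwiseMeasurableOn X (WeakToStrong.composedClass 𝓕s hs))
        (_ : WeakToStrong.complexityConst μ X (WeakToStrong.composedClass 𝓕s hs) ≠ ⊤)
        -- the strong ceiling model
        (fs : WeakToStrong.Vec ds → ℝ) (_ : fs ∈ 𝓕s)
        (_ : IsMinOn (fun f => WeakToStrong.outputDiv μ X (fstar ∘ hstar) (f ∘ hs)) 𝓕s fs)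
        (ε : ℝ) (_ : ε = WeakToStrong.outputDiv μ X (fstar ∘ hstar) (fs ∘ hs))
        (n : ℕ) (_ : 0 < n) (δ : ℝ) (_ : 0 < δ) (_ : δ < 1),
        -- with probability at least `1 - δ` over the sample
        ∃ A : Set (Fin n → WeakToStrong.Vec d), MeasurableSet A ∧
          ENNReal.ofReal (1 - δ) ≤ WeakToStrong.sampleLaw μ X n A ∧
          ∀ x ∈ A,
            -- for every empirical risk minimizer with respect to the reverse KL loss
            ∀ fsw ∈ 𝓕s,
              IsMinOn (fun f => WeakToStrong.empOutputDiv x (f ∘ hs) (fw ∘ hw)) 𝓕s fsw →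
              WeakToStrong.outputDiv μ X (fstar ∘ hstar) (fsw ∘ hs) ≤
                WeakToStrong.outputDiv μ X (fstar ∘ hstar) (fw ∘ hw)
                  - WeakToStrong.outputDiv μ X (fsw ∘ hs) (fw ∘ hw)
                  + K₁ * Real.sqrt ε
                  + K₂ * Real.sqrt
                      ((WeakToStrong.complexityConst μ X
                        (WeakToStrong.composedClass 𝓕s hs)).toReal / n)
                  + K₃ * Real.sqrt (Real.log (1 / δ) / n) := by
  have hK : 0 < 1 / γ := by positivity
  -- In the last two constants, `1/γ` bounds `μ.real X`. Then `2` is from symmetrization and `2/γ +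
  -- 1` is the Lipschitz constant, while `1/γ + 1` is the uniform bound on `lossGrad`.
  refine ⟨2 / γ ^ 2, 1 / γ * (2 * (2 / γ + 1)), 1 / γ * (2 * (1 / γ + 1)), by positivity,
    by positivity, by positivity, ?_⟩
  intro d dstar dw ds X hX μ hstar fstar hw fw hs 𝓕s hG hH hmod hconv hVm hC fs hfs _ ε hε n hn δ
    hδ0 hδ1
  have hS := hmod fs hfs
  have hn' : (0 : ℝ) < n := by exact_mod_cast hn
  have hlog : 0 < Real.log (1 / δ) := Real.log_pos (by rw [lt_div_iff₀ hδ0]; linarith)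
  set V := WeakToStrong.composedClass 𝓕s hs with V_def
  set q := √((WeakToStrong.complexityConst μ X V).toReal / n) with q_def
  set r := √(Real.log (1 / δ) / n) with r_def
  have hV : ∀ v ∈ V, WeakToStrong.IsModel μ X γ v := by
    rintro _ ⟨f, hf, rfl⟩; exact hmod f hf
  have hR := WeakToStrong.rademacher_le_sqrt hC hn
  obtain ⟨A, hAm, hAP, hA⟩ := WeakToStrong.exists_event_setIntegral_lossGrad_le
    (s := 2 * (1 / γ + 1) * r) (T := 2 * ((2 / γ + 1) * q) + 2 * (1 / γ + 1) * r)
    hγ hX hS hH hV ⟨_, fs, hfs, rfl⟩ hVm hn (by positivity) (by gcongr)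
  refine ⟨A, hAm, le_trans (ENNReal.ofReal_le_ofReal ?_) hAP, ?_⟩
  · have hr : n * r ^ 2 = Real.log (1 / δ) := by
      rw [r_def, Real.sq_sqrt (by positivity)]; field_simp
    -- The choice of `s` makes the failure probability `δ²`, which is below `δ`.
    have e : -(n * (2 * (1 / γ + 1) * r) ^ 2) / (2 * (1 / γ + 1) ^ 2) =
        -2 * Real.log (1 / δ) := by
      rw [← hr]
      have : (1 / γ + 1) ≠ 0 := by positivity
      generalize 1 / γ + 1 = B at this
      field_simp
    rw [e]
    have : Real.exp (-2 * Real.log (1 / δ)) ≤ Real.exp (Real.log δ) := by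
      rw [one_div, Real.log_inv] at hlog ⊢
      exact Real.exp_le_exp.2 (by linarith)
    rw [Real.exp_log hδ0] at this
    linarith
  · intro x hxA fsw hfsw hmin
    obtain ⟨hxX, hdev⟩ := hA x hxA
    have hF := hmod fsw hfsw
    have hopt : ∑ k, WeakToStrong.lossGrad ((fs ∘ hs) (x k)) ((fw ∘ hw) (x k))
        ((fsw ∘ hs) (x k)) ≤ 0 := by
      refine WeakToStrong.sum_lossGrad_nonpos (fun k => hγ.trans_le (hF.lower _ (hxX k)))
        (fun k => hγ.trans_le (hS.lower _ (hxX k))) (fun k => hγ.trans_le (hH.lower _ (hxX k)))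
        fun t ht ht1 => ?_
      -- Convexity keeps the segment from the minimizer to the strong ceiling inside the class.
      exact hmin (hconv hfsw hfs (sub_nonneg.2 ht1) ht.le (by ring))
    have h1 := hdev _ ⟨fsw, hfsw, rfl⟩
    have h2 := WeakToStrong.outputDiv_le_add_integral_lossGrad hF hG hH hS hγ hX
    have hM := hF.measureReal_le hγ hX
    set T := 2 * ((2 / γ + 1) * q) + 2 * (1 / γ + 1) * r with T_def
    have h3 : μ.real X * (T + (n : ℝ)⁻¹ * ∑ k, WeakToStrong.lossGrad ((fs ∘ hs) (x k))
        ((fw ∘ hw) (x k)) ((fsw ∘ hs) (x k))) ≤ 1 / γ * T := by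
      have hneg := mul_nonpos_of_nonneg_of_nonpos (inv_nonneg.2 hn'.le) hopt
      have hT : 0 ≤ T := by positivity
      calc _ ≤ μ.real X * T :=
            mul_le_mul_of_nonneg_left (by linarith) MeasureTheory.measureReal_nonneg
        _ ≤ _ := by gcongr
    have h4 : 1 / γ * T = 1 / γ * (2 * (2 / γ + 1)) * q + 1 / γ * (2 * (1 / γ + 1)) * r := by
      rw [T_def]; ring
    rw [hε]
    linarith
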